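/- Let $\Delta$ be an irreducible root system of ADE type ($A_n$ with $n\ge 1$, $D_n$ with $n\ge 4$, $E_6$, $E_7$ or $E_8$), let $n$ be its rank, let $G_\Delta\subset SL(2,\mathbb{C})$ be the corresponding finite subgroup (cyclic of order $n+1$ for $A_n$; binary dihedral of order $4(n-2)$ for $D_n$; binary tetrahedral, octahedral, icosahedral for $E_6$, $E_7$, $E_8$), and let $k=|G_\Delta|$. With $\eta(\tau)=e^{2\pi i\tau/24}\prod_{m\ge1}(1-e^{2\pi i m\tau})$ the Dedekind eta function, define on the upper half-plane $\mathbb{H}$ $$\eta_{A_n}(\tau)=\frac{\eta((n+1)\tau)^{n+1}}{\eta(\tau)},\qquad \eta_{D_n}(\tau)=\frac{\eta(2\tau)^2\,\eta((4n-8)\tau)^{n+2}}{\eta(\tau)\,\eta(4\tau)\,\eta((2n-4)\tau)^2},\qquad \eta_{E_6}(\tau)=\frac{\eta(2\tau)^2\,\eta(24\tau)^{8}}{\eta(\tau)\,\eta(8\tau)^2\,\eta(12\tau)},$$ $$\eta_{E_7}(\tau)=\frac{\eta(2\tau)^2\,\eta(48\tau)^{9}}{\eta(\tau)\,\eta(12\tau)\,\eta(16\tau)\,\eta(24\tau)},\qquad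 \eta_{E_8}(\tau)=\frac{\eta(2\tau)^2\,\eta(120\tau)^{10}}{\eta(\tau)\,\eta(24\tau)\,\eta(40\tau)\,\eta(60\tau)}.$$ Then $\eta_\Delta$ is a holomorphic modular form of weight $n/2$ for $\Gamma_0(k)$ with some multiplier system: it is holomorphic on $\mathbb{H}$, there is a function $\chi\colon\Gamma_0(k)\to\mathbb{C}^*$ with $|\chi|=1$ such that $\eta_\Delta\!\left(\frac{a\tau+b}{c\tau+d}\right)=\chi(A)(c\tau+d)^{n/2}\eta_\Delta(\tau)$ for all $A=\begin{pmatrix}a&b\\c&d\end{pmatrix}\in\Gamma_0(k)$ and $\tau\in\mathbb{H}$ (principal value of the power), and $\eta_\Delta$ is holomorphic at every cusp in $\mathbb{Q}\cup\{\infty\}$. Moreover, its order at the cusp $1$ is $0$, its order at the cusp $\infty$ is $\frac{(n+1)k-1}{24}$, and its order at the cusp $\frac1c$ is positive for every positive divisor $c\neq 1$ of $k$. Here the order of $f$ at a cusp $s$ is the least exponent of $q=e^{2\pi i\tau}$ that occurs in the expansion of $(c\tau+d)^{-n/2}f(A\tau)$ in fractional powers of $q$, where $A=\begin{pmatrix}a&b\\c&d\end{pmatrix}\in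 SL(2,\mathbb{Z})$ is any matrix with $A\infty=s$; $f$ is holomorphic at $s$ if only nonnegative exponents occur. -/

import Mathlib

noncomputable section

/-- The irreducible root systems of type ADE. -/
inductive ADEType : Type
  | A (n : ℕ) (hn : 1 ≤ n) : ADEType
  | D (n : ℕ) (hn : 4 ≤ n) : ADEType
  | E6 : ADEType
  | E7 : ADEType
  | E8 : ADEType

namespace ADEType

/-- The rank of the root system. -/
def rank : ADEType → ℕ
  | A n _ => n
  | D n _ => n
  | E6 => 6
  | E7 => 7
  | E8 => 8

/-- The unit quaternion `a + b i + c j + d k` as an element of `SU(2) ⊆ SL(2, ℂ)`. -/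
def unitQuaternion (a b c d : ℝ) (h : a ^ 2 + b ^ 2 + c ^ 2 + d ^ 2 = 1) :
    Matrix.SpecialLinearGroup (Fin 2) ℂ :=
  ⟨!![(a : ℂ) + b * Complex.I, (c : ℂ) + d * Complex.I;
      -(c : ℂ) + d * Complex.I, (a : ℂ) - b * Complex.I], by
    have h' : (a : ℂ) ^ 2 + (b : ℂ) ^ 2 + (c : ℂ) ^ 2 + (d : ℂ) ^ 2 = 1 := by exact_mod_cast h
    rw [Matrix.det_fin_two_of]
    linear_combination h' - ((b : ℂ) ^ 2 + (d : ℂ) ^ 2) * Complex.I_sq⟩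

/-- The quaternion `cos t + i sin t`, that is, the matrix `diag(exp(i t), exp(-i t))`. -/
def rotation (t : ℝ) : Matrix.SpecialLinearGroup (Fin 2) ℂ :=
  unitQuaternion (Real.cos t) (Real.sin t) 0 0 (by simp)

/-- The quaternion `i`. -/
def quatI : Matrix.SpecialLinearGroup (Fin 2) ℂ :=
  unitQuaternion 0 1 0 0 (by norm_num)

/-- The quaternion `j`. -/
def quatJ : Matrix.SpecialLinearGroup (Fin 2) ℂ :=
  unitQuaternion 0 0 1 0 (by norm_num)

/-- The quaternion `(1 + i + j + k) / 2`. -/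
def quatS : Matrix.SpecialLinearGroup (Fin 2) ℂ :=
  unitQuaternion (1 / 2) (1 / 2) (1 / 2) (1 / 2) (by norm_num)

/-- The quaternion `(φ + φ⁻¹ i + j) / 2`, where `φ` is the golden ratio. -/
def quatT : Matrix.SpecialLinearGroup (Fin 2) ℂ :=
  unitQuaternion (Real.goldenRatio / 2) (Real.goldenRatio⁻¹ / 2) (1 / 2) 0 (by
    have h1 : Real.goldenRatio⁻¹ = Real.goldenRatio - 1 := by
      rw [Real.inv_goldenRatio]
      linarith [Real.goldenRatio_add_goldenConj]
    rw [h1]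
    nlinarith [Real.goldenRatio_sq])

/-- The finite subgroup `G_Δ` of `SL(2, ℂ)` corresponding to `Δ` (well defined up to conjugacy):
cyclic of order `n + 1` for `A_n`, binary dihedral of order `4 (n - 2)` for `D_n`, and the binary
tetrahedral, octahedral and icosahedral groups for `E₆`, `E₇`, `E₈`, each given by generators. -/
def kleinianGroup : ADEType → Subgroup (Matrix.SpecialLinearGroup (Fin 2) ℂ)
  | A n _ => Subgroup.closure {rotation (2 * Real.pi / ((n : ℝ) + 1))}
  | D n _ => Subgroup.closure {rotation (Real.pi / ((n : ℝ) - 2)), quatJ}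
  | E6 => Subgroup.closure {quatI, quatS}
  | E7 => Subgroup.closure {rotation (Real.pi / 4), quatS}
  | E8 => Subgroup.closure {quatS, quatT}

/-- `k = |G_Δ|`. -/
def groupOrder (Δ : ADEType) : ℕ := Nat.card Δ.kleinianGroup

/-- The scaled Dedekind eta function `τ ↦ η(m τ)` on the upper half-plane. -/
def etaScaled (m : ℕ) (τ : UpperHalfPlane) : ℂ := ModularForm.eta ((m : ℂ) * (τ : ℂ))

/-- The eta product `η_Δ`. -/
def etaProduct : ADEType → UpperHalfPlane → ℂ
  | A n _ => fun τ => etaScaled (n + 1) τ ^ (n + 1) / etaScaled 1 τ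
  | D n _ => fun τ =>
      etaScaled 2 τ ^ 2 * etaScaled (4 * n - 8) τ ^ (n + 2) /
        (etaScaled 1 τ * etaScaled 4 τ * etaScaled (2 * n - 4) τ ^ 2)
  | E6 => fun τ =>
      etaScaled 2 τ ^ 2 * etaScaled 24 τ ^ 8 /
        (etaScaled 1 τ * etaScaled 8 τ ^ 2 * etaScaled 12 τ)
  | E7 => fun τ =>
      etaScaled 2 τ ^ 2 * etaScaled 48 τ ^ 9 /
        (etaScaled 1 τ * etaScaled 12 τ * etaScaled 16 τ * etaScaled 24 τ)
  | E8 => fun τ =>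
      etaScaled 2 τ ^ 2 * etaScaled 120 τ ^ 10 /
        (etaScaled 1 τ * etaScaled 24 τ * etaScaled 40 τ * etaScaled 60 τ)

end ADEType

namespace MultiplierForm

/-- The automorphy factor `(c τ + d) ^ w` of real weight `w`, with the principal value of the
power. -/
def autFactor (w : ℝ) (A : Matrix.SpecialLinearGroup (Fin 2) ℤ) (τ : UpperHalfPlane) : ℂ :=
  (((A 1 0 : ℤ) : ℂ) * (τ : ℂ) + ((A 1 1 : ℤ) : ℂ)) ^ (w : ℂ)

/-- The function `τ ↦ (c τ + d) ^ (-w) f(A τ)`, whose behaviour at `i∞` describes `f` at the cusp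
`A ∞`. -/
def slash (w : ℝ) (f : UpperHalfPlane → ℂ) (A : Matrix.SpecialLinearGroup (Fin 2) ℤ)
    (τ : UpperHalfPlane) : ℂ :=
  autFactor (-w) A τ * f (A • τ)

/-- `g` has, on all of the upper half-plane, the convergent Fourier expansion
`g(τ) = ∑_{m ≥ 0} a_m q ^ (r + m / h)` with `q ^ s = exp(2 π i s τ)`. -/
def HasFourierExpansion (g : UpperHalfPlane → ℂ) (r : ℝ) (h : ℕ) (a : ℕ → ℂ) : Prop :=
  ∀ τ : UpperHalfPlane,
    HasSum (fun m : ℕ =>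
      a m * Complex.exp (2 * Real.pi * Complex.I * (((r + (m : ℝ) / (h : ℝ) : ℝ) : ℂ)) * (τ : ℂ)))
      (g τ)

/-- The function `f`, regarded in weight `w`, has order `r` at the cusp `s ∈ ℚ ∪ {∞}`: for the
matrices `A` in `SL(2, ℤ)` with `A ∞ = s`, the least exponent of `q` that occurs in the Fourier
expansion of `(c τ + d) ^ (-w) f(A τ)` is `r`.  (Exponents are those of `q = exp(2 π i τ)`, not
of `q ^ (1 / width)`.) -/
def HasOrderAtCusp (w : ℝ) (f : UpperHalfPlane → ℂ) (s : OnePoint ℚ) (r : ℝ) : Prop :=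
  ∀ A : Matrix.SpecialLinearGroup (Fin 2) ℤ,
    Matrix.SpecialLinearGroup.mapGL ℚ A • (OnePoint.infty : OnePoint ℚ) = s →
    ∃ (h : ℕ) (a : ℕ → ℂ), 0 < h ∧ a 0 ≠ 0 ∧ HasFourierExpansion (slash w f A) r h a

/-- `f` is holomorphic at the cusp `s ∈ ℚ ∪ {∞}`: the Fourier expansions there involve only
nonnegative exponents. -/
def HolomorphicAtCusp (w : ℝ) (f : UpperHalfPlane → ℂ) (s : OnePoint ℚ) : Prop :=
  ∀ A : Matrix.SpecialLinearGroup (Fin 2) ℤ,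
    Matrix.SpecialLinearGroup.mapGL ℚ A • (OnePoint.infty : OnePoint ℚ) = s →
    ∃ (r : ℝ) (h : ℕ) (a : ℕ → ℂ), 0 ≤ r ∧ 0 < h ∧ HasFourierExpansion (slash w f A) r h a

/-- `f` is a (holomorphic) modular form of weight `w` with multiplier system `χ` for the finite
index subgroup `Γ` of `SL(2, ℤ)`. -/
structure IsModularForm (w : ℝ) (Γ : Subgroup (Matrix.SpecialLinearGroup (Fin 2) ℤ))
    (χ : Γ → ℂ) (f : UpperHalfPlane → ℂ) : Prop where
  finiteIndex : Γ.FiniteIndex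
  norm_multiplier : ∀ A : Γ, ‖χ A‖ = 1
  holomorphic : MDifferentiable (modelWithCornersSelf ℂ ℂ) (modelWithCornersSelf ℂ ℂ) f
  transform : ∀ (A : Γ) (τ : UpperHalfPlane),
    f ((A : Matrix.SpecialLinearGroup (Fin 2) ℤ) • τ) = χ A * autFactor w A τ * f τ
  holomorphic_cusp : ∀ s : OnePoint ℚ, HolomorphicAtCusp w f s

end MultiplierForm

end

/-!
The proof has two independent parts.

*The order of `G_Δ`.* The generators are unit quaternions. The cyclic group is handled by the order
of a rotation; the other groups are built up by coset enumeration (`card_closure_of_cosets`): the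
binary dihedral group is two cosets of a cyclic group, the binary tetrahedral group three cosets of
the quaternion group, the binary octahedral group two cosets and the binary icosahedral group five
cosets of the binary tetrahedral group. That the cosets are distinct is seen from the coordinates:
those of the quaternion group are integers, those of the binary tetrahedral group are rational, and
`√2` and the golden ratio are irrational.

*Eta quotients.* Since `η ^ 24` is a modular form of weight 12, `η(A τ)` is
`ε (c τ + d) ^ (1 / 2) η(τ)` with a constant `ε` of absolute value 1 (`exists_eta_smul`); the value
of `ε` is never needed. For `m ≥ 1` the matrix `diag(m, 1) A` is a product of an element of
`SL(2, ℤ)` and an upper triangular matrix with diagonal `(g, m / g)`, where `g = gcd(c, m)`. So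
`η(m A τ)` is a nonzero constant times `(c τ + d) ^ (1 / 2)` times
`q ^ (g ^ 2 / (24 m)) ∏ (1 - (ζ q ^ (g ^ 2 / m)) ^ n)` (`exists_etaScaled_smul`). Multiplying over
the factors, an eta quotient `∏ η(m_i τ) ^ (r_i)` has order `∑ r_i gcd(c, m_i) ^ 2 / (24 m_i)` at
every cusp with denominator `c` (`exists_fourierExpansion_slash_etaQuotient`). This depends only on
the gcd of `c` and the level, and it remains to evaluate the sum for the divisors `c` of `k`.
-/

section KleinianGroups

/-! ### Coset enumeration and unit quaternions -/

open scoped Pointwise goldenRatio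

/-- Coset enumeration: if left multiplication by each generator permutes the distinct left cosets
`g i * H`, one of which is `H`, then these cosets exhaust the group generated. -/
theorem card_closure_of_cosets {G : Type*} [Group G] {S : Set G} {H : Subgroup G} {n : ℕ}
    (g : Fin n → G) (hone : ∃ i, g i = 1) (hH : H ≤ Subgroup.closure S)
    (hg : ∀ i, g i ∈ Subgroup.closure S)
    (hS : ∀ s ∈ S, ∀ i, ∃ j, (g j)⁻¹ * (s * g i) ∈ H)
    (hne : ∀ i j, (g i)⁻¹ * g j ∈ H → i = j) :
    Nat.card (Subgroup.closure S) = n * Nat.card H := by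
  set X : Set (G ⧸ H) := Set.range fun i => (g i : G ⧸ H) with hX
  have hXfin : X.Finite := Set.finite_range _
  have hstab : Subgroup.closure S ≤ MulAction.stabilizer G X := by
    rw [Subgroup.closure_le]
    intro s hs
    -- For a finite set, being mapped into itself by `s` is the same as being stabilized by `s`.
    rw [SetLike.mem_coe, MulAction.mem_stabilizer_set_iff_smul_set_subset hXfin]
    rintro _ ⟨_, ⟨i, rfl⟩, rfl⟩
    obtain ⟨j, hj⟩ := hS s hs i
    exact ⟨j, QuotientGroup.eq.mpr hj⟩
  have hcover : ∀ x ∈ Subgroup.closure S, ∃ j, (g j)⁻¹ * x ∈ H := by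
    intro x hx
    obtain ⟨i, hi⟩ := hone
    have h1 : (x : G ⧸ H) ∈ X := by
      rw [← MulAction.mem_stabilizer_iff.mp (hstab hx)]
      refine ⟨((1 : G) : G ⧸ H), ⟨i, by simp [hi]⟩, ?_⟩
      simp
    obtain ⟨j, hj⟩ := h1
    exact ⟨j, QuotientGroup.eq.mp hj⟩
  have hbij : Function.Bijective (fun p : Fin n × H =>
      (⟨g p.1 * p.2, mul_mem (hg _) (hH p.2.2)⟩ : Subgroup.closure S)) := by
    constructor
    · rintro ⟨i, h⟩ ⟨j, k⟩ hp
      have hp' : g i * h = g j * k := congrArg Subtype.val hp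
      have hij : i = j := hne i j (by
        have : (g i)⁻¹ * g j = h * (k : G)⁻¹ := by
          rw [eq_mul_inv_iff_mul_eq, mul_assoc, ← hp', inv_mul_cancel_left]
        rw [this]
        exact mul_mem h.2 (inv_mem k.2))
      subst hij
      simpa using hp'
    · rintro ⟨x, hx⟩
      obtain ⟨j, hj⟩ := hcover x hx
      exact ⟨(j, ⟨_, hj⟩), by simp⟩
  rw [← Nat.card_eq_of_bijective _ hbij, Nat.card_prod, Nat.card_fin]

namespace ADEType

/-- The Hamilton product. -/
lemma unitQuaternion_mul {a b c d a' b' c' d' a'' b'' c'' d'' : ℝ}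
    {h : a ^ 2 + b ^ 2 + c ^ 2 + d ^ 2 = 1} {h' : a' ^ 2 + b' ^ 2 + c' ^ 2 + d' ^ 2 = 1}
    {h'' : a'' ^ 2 + b'' ^ 2 + c'' ^ 2 + d'' ^ 2 = 1}
    (ha : a * a' - b * b' - c * c' - d * d' = a'') (hb : a * b' + b * a' + c * d' - d * c' = b'')
    (hc : a * c' - b * d' + c * a' + d * b' = c'') (hd : a * d' + b * c' - c * b' + d * a' = d'') :
    unitQuaternion a b c d h * unitQuaternion a' b' c' d' h' =
      unitQuaternion a'' b'' c'' d'' h'' := by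
  subst ha hb hc hd
  ext i j
  rw [Matrix.SpecialLinearGroup.coe_mul]
  fin_cases i <;> fin_cases j <;>
    simp [unitQuaternion, Complex.ext_iff] <;> constructor <;> ring

lemma unitQuaternion_injective {a b c d a' b' c' d' : ℝ}
    {h : a ^ 2 + b ^ 2 + c ^ 2 + d ^ 2 = 1} {h' : a' ^ 2 + b' ^ 2 + c' ^ 2 + d' ^ 2 = 1}
    (H : unitQuaternion a b c d h = unitQuaternion a' b' c' d' h') :
    a = a' ∧ b = b' ∧ c = c' ∧ d = d' := by
  have h00 := congrArg (fun M : Matrix.SpecialLinearGroup (Fin 2) ℂ => M 0 0) H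
  have h01 := congrArg (fun M : Matrix.SpecialLinearGroup (Fin 2) ℂ => M 0 1) H
  simp [unitQuaternion, Complex.ext_iff] at h00 h01
  exact ⟨h00.1, h00.2, h01.1, h01.2⟩

lemma unitQuaternion_one : unitQuaternion 1 0 0 0 (by norm_num) = 1 := by
  ext i j
  fin_cases i <;> fin_cases j <;> simp [unitQuaternion]

lemma unitQuaternion_inv {a b c d : ℝ} {h : a ^ 2 + b ^ 2 + c ^ 2 + d ^ 2 = 1} :
    (unitQuaternion a b c d h)⁻¹ =
      unitQuaternion a (-b) (-c) (-d) (by linear_combination h) := by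
  rw [inv_eq_iff_mul_eq_one, ← unitQuaternion_one]
  apply unitQuaternion_mul
  · linear_combination h
  all_goals ring

/-- The unit quaternions whose coordinates lie in a given subring of `ℝ`. -/
def coordSubgroup (R : Subring ℝ) : Subgroup (Matrix.SpecialLinearGroup (Fin 2) ℂ) where
  carrier := {M | ∃ a ∈ R, ∃ b ∈ R, ∃ c ∈ R, ∃ d ∈ R, ∃ h, M = unitQuaternion a b c d h}
  one_mem' := ⟨1, one_mem _, 0, zero_mem _, 0, zero_mem _, 0, zero_mem _, _,
    unitQuaternion_one.symm⟩
  mul_mem' := by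
    rintro _ _ ⟨a, ha, b, hb, c, hc, d, hd, h, rfl⟩ ⟨a', ha', b', hb', c', hc', d', hd', h', rfl⟩
    refine ⟨a * a' - b * b' - c * c' - d * d', ?_, a * b' + b * a' + c * d' - d * c', ?_,
      a * c' - b * d' + c * a' + d * b', ?_, a * d' + b * c' - c * b' + d * a', ?_, ?_,
      unitQuaternion_mul rfl rfl rfl rfl⟩
    · exact sub_mem (sub_mem (sub_mem (mul_mem ha ha') (mul_mem hb hb')) (mul_mem hc hc'))
        (mul_mem hd hd')
    · exact sub_mem (add_mem (add_mem (mul_mem ha hb') (mul_mem hb ha')) (mul_mem hc hd'))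
        (mul_mem hd hc')
    · exact add_mem (add_mem (sub_mem (mul_mem ha hc') (mul_mem hb hd')) (mul_mem hc ha'))
        (mul_mem hd hb')
    · exact add_mem (sub_mem (add_mem (mul_mem ha hd') (mul_mem hb hc')) (mul_mem hc hb'))
        (mul_mem hd ha')
    · linear_combination (a' ^ 2 + b' ^ 2 + c' ^ 2 + d' ^ 2) * h + h'
  inv_mem' := by
    rintro _ ⟨a, ha, b, hb, c, hc, d, hd, h, rfl⟩
    exact ⟨a, ha, -b, neg_mem hb, -c, neg_mem hc, -d, neg_mem hd, _, unitQuaternion_inv⟩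

lemma unitQuaternion_mem_coordSubgroup {R : Subring ℝ} {a b c d : ℝ}
    {h : a ^ 2 + b ^ 2 + c ^ 2 + d ^ 2 = 1} :
    unitQuaternion a b c d h ∈ coordSubgroup R ↔ a ∈ R ∧ b ∈ R ∧ c ∈ R ∧ d ∈ R := by
  constructor
  · rintro ⟨a', ha, b', hb, c', hc, d', hd, h', H⟩
    obtain ⟨rfl, rfl, rfl, rfl⟩ := unitQuaternion_injective H
    exact ⟨ha, hb, hc, hd⟩
  · rintro ⟨ha, hb, hc, hd⟩
    exact ⟨a, ha, b, hb, c, hc, d, hd, h, rfl⟩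

lemma rotation_mul (s t : ℝ) : rotation s * rotation t = rotation (s + t) := by
  apply unitQuaternion_mul
  · rw [Real.cos_add]; ring
  · rw [Real.sin_add]; ring
  all_goals ring

lemma rotation_zero : rotation 0 = 1 := by
  rw [← unitQuaternion_one]
  simp [rotation]

lemma rotation_pow (t : ℝ) (m : ℕ) : rotation t ^ m = rotation (m * t) := by
  induction m with
  | zero => simp [rotation_zero]
  | succ m ih => rw [pow_succ, ih, rotation_mul]; push_cast; ring_nf

lemma rotation_inv (t : ℝ) : (rotation t)⁻¹ = rotation (-t) := by
  rw [inv_eq_iff_mul_eq_one, rotation_mul, add_neg_cancel, rotation_zero]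

lemma rotation_zpow (t : ℝ) (m : ℤ) : rotation t ^ m = rotation (m * t) := by
  obtain ⟨k, rfl | rfl⟩ := m.eq_nat_or_neg
  · rw [zpow_natCast, rotation_pow]; push_cast; rfl
  · rw [zpow_neg, zpow_natCast, rotation_pow, rotation_inv]; push_cast; ring_nf

lemma rotation_eq_one_iff (t : ℝ) : rotation t = 1 ↔ ∃ m : ℤ, t = m * (2 * Real.pi) := by
  have h1 : rotation t = 1 ↔ Real.cos t = 1 := by
    rw [← unitQuaternion_one]
    constructor
    · exact fun h => (unitQuaternion_injective h).1
    · intro h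
      have h2 : Real.sin t = 0 := by nlinarith [Real.sin_sq_add_cos_sq t]
      simp [rotation, h, h2]
  rw [h1, Real.cos_eq_one_iff]
  simp only [eq_comm]

lemma orderOf_rotation {m : ℕ} (hm : 0 < m) : orderOf (rotation (2 * Real.pi / m)) = m := by
  have hm' : (m : ℝ) ≠ 0 := by positivity
  rw [orderOf_eq_iff hm]
  constructor
  · rw [rotation_pow, rotation_eq_one_iff]
    exact ⟨1, by field_simp; simp⟩
  · intro k hk hk0 h
    rw [rotation_pow, rotation_eq_one_iff] at h
    obtain ⟨j, hj⟩ := h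
    have h2 : (k : ℝ) = j * m := by
      field_simp at hj
      linarith
    have h3 : (k : ℤ) = j * m := by exact_mod_cast h2
    have h4 : (m : ℤ) ∣ k := ⟨j, by rw [h3]; ring⟩
    have := Nat.le_of_dvd hk0 (Int.natCast_dvd_natCast.mp h4)
    omega

lemma quatJ_mul_quatJ : quatJ * quatJ = rotation Real.pi := by
  apply unitQuaternion_mul <;> simp

lemma quatJ_mul_rotation (t : ℝ) : quatJ * rotation t = rotation (-t) * quatJ := by
  have h : (0 : ℝ) ^ 2 + 0 ^ 2 + Real.cos t ^ 2 + (-Real.sin t) ^ 2 = 1 := by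
    have := Real.sin_sq_add_cos_sq t
    linarith
  trans unitQuaternion 0 0 (Real.cos t) (-Real.sin t) h
  · apply unitQuaternion_mul <;> simp
  · symm
    apply unitQuaternion_mul <;> simp

/-- The binary dihedral group is the union of two cosets of its cyclic subgroup of rotations. -/
lemma card_binaryDihedral {N : ℕ} (hN : 0 < N) :
    Nat.card (Subgroup.closure {rotation (Real.pi / N), quatJ}) = 4 * N := by
  have hN' : (N : ℝ) ≠ 0 := by positivity
  have hcard : Nat.card (Subgroup.zpowers (rotation (Real.pi / N))) = 2 * N := by
    rw [Nat.card_zpowers]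
    have := orderOf_rotation (m := 2 * N) (by omega)
    push_cast at this
    rwa [mul_div_mul_left _ _ two_ne_zero] at this
  have hmem : rotation (Real.pi / N) ∈ Subgroup.closure {rotation (Real.pi / N), quatJ} :=
    Subgroup.subset_closure (by simp)
  have hJ : quatJ ∈ Subgroup.closure {rotation (Real.pi / N), quatJ} :=
    Subgroup.subset_closure (by simp)
  have hpi : rotation Real.pi ∈ Subgroup.zpowers (rotation (Real.pi / N)) :=
    ⟨N, by simp only [rotation_zpow]; congr 1; push_cast; field_simp⟩
  have hJnot : quatJ ∉ Subgroup.zpowers (rotation (Real.pi / N)) := by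
    rintro ⟨m, hm⟩
    simp only [rotation_zpow] at hm
    have := (unitQuaternion_injective hm).2.2.1
    norm_num at this
  rw [card_closure_of_cosets (H := Subgroup.zpowers (rotation (Real.pi / N))) ![1, quatJ]
    ⟨0, rfl⟩ (by rwa [Subgroup.zpowers_le]), hcard]
  · ring
  · intro i
    fin_cases i
    · exact one_mem _
    · exact hJ
  · rintro s (rfl | rfl) i
    · fin_cases i
      · exact ⟨0, by simp⟩
      · refine ⟨1, ?_⟩
        have : quatJ⁻¹ * (rotation (Real.pi / N) * quatJ) = (rotation (Real.pi / N))⁻¹ := by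
          rw [inv_mul_eq_iff_eq_mul, rotation_inv, quatJ_mul_rotation, neg_neg]
        simp [this]
    · fin_cases i
      · exact ⟨1, by simp⟩
      · exact ⟨0, by simpa [quatJ_mul_quatJ] using hpi⟩
  · intro i j
    fin_cases i <;> fin_cases j <;> simp [hJnot]

/-! ### Orders of the binary polyhedral groups -/

lemma unitQuaternion_mul_eq_mul {a b c d a' b' c' d' e f g j e' f' g' j' : ℝ}
    {h : a ^ 2 + b ^ 2 + c ^ 2 + d ^ 2 = 1} {h' : a' ^ 2 + b' ^ 2 + c' ^ 2 + d' ^ 2 = 1}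
    {k : e ^ 2 + f ^ 2 + g ^ 2 + j ^ 2 = 1} {k' : e' ^ 2 + f' ^ 2 + g' ^ 2 + j' ^ 2 = 1}
    (h1 : a * a' - b * b' - c * c' - d * d' = e * e' - f * f' - g * g' - j * j')
    (h2 : a * b' + b * a' + c * d' - d * c' = e * f' + f * e' + g * j' - j * g')
    (h3 : a * c' - b * d' + c * a' + d * b' = e * g' - f * j' + g * e' + j * f')
    (h4 : a * d' + b * c' - c * b' + d * a' = e * j' + f * g' - g * f' + j * e') :
    unitQuaternion a b c d h * unitQuaternion a' b' c' d' h' =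
      unitQuaternion e f g j k * unitQuaternion e' f' g' j' k' := by
  have hn : (e * e' - f * f' - g * g' - j * j') ^ 2 + (e * f' + f * e' + g * j' - j * g') ^ 2 +
      (e * g' - f * j' + g * e' + j * f') ^ 2 + (e * j' + f * g' - g * f' + j * e') ^ 2 = 1 := by
    linear_combination (e' ^ 2 + f' ^ 2 + g' ^ 2 + j' ^ 2) * k + k'
  rw [unitQuaternion_mul (h'' := hn) h1 h2 h3 h4, unitQuaternion_mul rfl rfl rfl rfl]

/-- The quaternion `k`. -/
def quatK : Matrix.SpecialLinearGroup (Fin 2) ℂ :=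
  unitQuaternion 0 0 0 1 (by norm_num)

/-- The quaternion `-1`. -/
def quatNegOne : Matrix.SpecialLinearGroup (Fin 2) ℂ :=
  unitQuaternion (-1) 0 0 0 (by norm_num)

lemma quatI_mul_quatI : quatI * quatI = quatNegOne := by
  apply unitQuaternion_mul <;> norm_num

lemma quatI_mul_quatJ : quatI * quatJ = quatK := by
  apply unitQuaternion_mul <;> norm_num

lemma quatI_mul_quatS : quatI * quatS = quatS * quatK := by
  apply unitQuaternion_mul_eq_mul <;> norm_num

lemma quatJ_mul_quatS : quatJ * quatS = quatS * quatI := by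
  apply unitQuaternion_mul_eq_mul <;> norm_num

lemma quatK_mul_quatS : quatK * quatS = quatS * quatJ := by
  apply unitQuaternion_mul_eq_mul <;> norm_num

lemma quatS_sq : quatS ^ 2 =
    unitQuaternion (-(1 / 2)) (1 / 2) (1 / 2) (1 / 2) (by norm_num) := by
  rw [pow_two]
  apply unitQuaternion_mul <;> norm_num

lemma quatS_cube : quatS ^ 3 = quatNegOne := by
  rw [pow_succ, quatS_sq]
  apply unitQuaternion_mul <;> norm_num

lemma rotation_pi_div_two : rotation (Real.pi / 2) = quatI := by
  simp [rotation, quatI]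

lemma card_quaternion_group : Nat.card (Subgroup.closure {quatI, quatJ}) = 8 := by
  have := card_binaryDihedral (N := 2) (by norm_num)
  rwa [Nat.cast_ofNat, rotation_pi_div_two] at this

/-- The quaternion group has integral coordinates, which separates it from its cosets. -/
lemma closure_quatI_quatJ_le :
    Subgroup.closure {quatI, quatJ} ≤ coordSubgroup (Int.castRingHom ℝ).range := by
  rw [Subgroup.closure_le]
  rintro x (rfl | rfl)
  · exact unitQuaternion_mem_coordSubgroup.mpr ⟨zero_mem _, one_mem _, zero_mem _, zero_mem _⟩
  · exact unitQuaternion_mem_coordSubgroup.mpr ⟨zero_mem _, zero_mem _, one_mem _, zero_mem _⟩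

lemma half_notMem_int : (1 / 2 : ℝ) ∉ (Int.castRingHom ℝ).range := by
  rintro ⟨m, hm⟩
  have h1 : (2 * m : ℝ) = 1 := by
    have : (m : ℝ) = 1 / 2 := hm
    rw [this]; norm_num
  have h2 : 2 * m = 1 := by exact_mod_cast h1
  omega

lemma quatJ_mem_tetrahedral : quatJ ∈ Subgroup.closure {quatI, quatS} := by
  have h : quatJ = quatS * quatI * quatS⁻¹ := by
    rw [eq_mul_inv_iff_mul_eq, quatJ_mul_quatS]
  rw [h]
  exact mul_mem (mul_mem (Subgroup.subset_closure (by simp)) (Subgroup.subset_closure (by simp)))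
    (inv_mem (Subgroup.subset_closure (by simp)))

/-- The binary tetrahedral group is the union of three cosets of the quaternion group, permuted
by the element `(1 + i + j + k) / 2`, which normalizes it. -/
lemma card_binaryTetrahedral : Nat.card (Subgroup.closure {quatI, quatS}) = 24 := by
  have hI : quatI ∈ Subgroup.closure {quatI, quatJ} := Subgroup.subset_closure (by simp)
  have hJ : quatJ ∈ Subgroup.closure {quatI, quatJ} := Subgroup.subset_closure (by simp)
  have hK : quatK ∈ Subgroup.closure {quatI, quatJ} := quatI_mul_quatJ ▸ mul_mem hI hJ
  have hN : quatNegOne ∈ Subgroup.closure {quatI, quatJ} := quatI_mul_quatI ▸ mul_mem hI hI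
  have hs : quatS ∉ Subgroup.closure {quatI, quatJ} := fun h =>
    half_notMem_int (unitQuaternion_mem_coordSubgroup.mp (closure_quatI_quatJ_le h)).1
  have hs2 : quatS ^ 2 ∉ Subgroup.closure {quatI, quatJ} := fun h => by
    rw [quatS_sq] at h
    exact half_notMem_int (unitQuaternion_mem_coordSubgroup.mp (closure_quatI_quatJ_le h)).2.1
  have hS : quatS ∈ Subgroup.closure {quatI, quatS} := Subgroup.subset_closure (by simp)
  rw [card_closure_of_cosets (H := Subgroup.closure {quatI, quatJ}) (n := 3)
    (fun i => quatS ^ (i : ℕ)) ⟨0, pow_zero _⟩, card_quaternion_group]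
  · rw [Subgroup.closure_le]
    rintro x (rfl | rfl)
    · exact Subgroup.subset_closure (by simp)
    · exact quatJ_mem_tetrahedral
  · exact fun i => pow_mem hS _
  · rintro x (rfl | rfl) i <;> fin_cases i
    · exact ⟨0, by simpa using hI⟩
    · exact ⟨1, by simpa [quatI_mul_quatS] using hK⟩
    · refine ⟨2, ?_⟩
      have : quatI * quatS ^ 2 = quatS ^ 2 * quatJ := by
        rw [pow_two, ← mul_assoc, quatI_mul_quatS, mul_assoc, quatK_mul_quatS, mul_assoc]
      simpa [this] using hJ
    · exact ⟨1, by simp⟩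
    · exact ⟨2, by simp [pow_two]⟩
    · exact ⟨0, by simpa [← pow_succ', quatS_cube] using hN⟩
  · have key : ∀ i j : Fin 3, i < j →
        (quatS ^ (i : ℕ))⁻¹ * quatS ^ (j : ℕ) ∉ Subgroup.closure {quatI, quatJ} := by
      intro i j hij
      fin_cases i <;> fin_cases j <;> simp_all [pow_two]
    intro i j h
    rcases lt_trichotomy i j with hij | hij | hij
    · exact absurd h (key i j hij)
    · exact hij
    · refine absurd ?_ (key j i hij)
      simpa using inv_mem h

/-- The binary tetrahedral group has rational coordinates, which separates it from its cosets in the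
binary octahedral and icosahedral groups. -/
lemma closure_quatI_quatS_le :
    Subgroup.closure {quatI, quatS} ≤ coordSubgroup (Rat.castHom ℝ).range := by
  have hhalf : (1 / 2 : ℝ) ∈ (Rat.castHom ℝ).range := ⟨1 / 2, by simp⟩
  rw [Subgroup.closure_le]
  rintro x (rfl | rfl)
  · exact unitQuaternion_mem_coordSubgroup.mpr ⟨zero_mem _, one_mem _, zero_mem _, zero_mem _⟩
  · exact unitQuaternion_mem_coordSubgroup.mpr ⟨hhalf, hhalf, hhalf, hhalf⟩

lemma rotation_pi_div_four_sq : rotation (Real.pi / 4) * rotation (Real.pi / 4) = quatI := by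
  rw [rotation_mul, ← rotation_pi_div_two]
  ring_nf

lemma quatS_mul_rotation_pi_div_four :
    quatS * rotation (Real.pi / 4) = rotation (Real.pi / 4) * (quatS⁻¹ * quatJ) := by
  have h : quatS⁻¹ * quatJ =
      unitQuaternion (1 / 2) (1 / 2) (1 / 2) (-(1 / 2)) (by norm_num) := by
    rw [quatS, unitQuaternion_inv]
    apply unitQuaternion_mul <;> norm_num
  rw [h]
  apply unitQuaternion_mul_eq_mul <;> rw [Real.cos_pi_div_four, Real.sin_pi_div_four] <;> ring

/-- The binary octahedral group contains the binary tetrahedral group with index two. -/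
lemma card_binaryOctahedral :
    Nat.card (Subgroup.closure {rotation (Real.pi / 4), quatS}) = 48 := by
  have hI : quatI ∈ Subgroup.closure {quatI, quatS} := Subgroup.subset_closure (by simp)
  have hS : quatS ∈ Subgroup.closure {quatI, quatS} := Subgroup.subset_closure (by simp)
  have hu : rotation (Real.pi / 4) ∈ Subgroup.closure {rotation (Real.pi / 4), quatS} :=
    Subgroup.subset_closure (by simp)
  have hunot : rotation (Real.pi / 4) ∉ Subgroup.closure {quatI, quatS} := fun h => by
    have h1 := (unitQuaternion_mem_coordSubgroup.mp (closure_quatI_quatS_le h)).1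
    rw [Real.cos_pi_div_four] at h1
    have h2 := add_mem h1 h1
    rw [add_halves] at h2
    exact irrational_sqrt_two h2
  rw [card_closure_of_cosets (H := Subgroup.closure {quatI, quatS}) ![1, rotation (Real.pi / 4)]
    ⟨0, rfl⟩, card_binaryTetrahedral]
  · rw [Subgroup.closure_le]
    rintro x (rfl | rfl)
    · rw [← rotation_pi_div_four_sq]
      exact mul_mem hu hu
    · exact Subgroup.subset_closure (by simp)
  · intro i
    fin_cases i
    · exact one_mem _
    · exact hu
  · rintro x (rfl | rfl) i <;> fin_cases i
    · exact ⟨1, by simp⟩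
    · exact ⟨0, by simpa [rotation_pi_div_four_sq] using hI⟩
    · exact ⟨0, by simpa using hS⟩
    · refine ⟨1, ?_⟩
      simpa [quatS_mul_rotation_pi_div_four] using mul_mem (inv_mem hS) quatJ_mem_tetrahedral
  · intro i j
    fin_cases i <;> fin_cases j <;> simp [hunot]

lemma quatT_eq : quatT = unitQuaternion (φ / 2) ((φ - 1) / 2) (1 / 2) 0
    (by nlinarith [Real.goldenRatio_sq]) := by
  have h1 : φ⁻¹ = φ - 1 := by
    rw [Real.inv_goldenRatio]
    linarith [Real.goldenRatio_add_goldenConj]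
  simp only [quatT, h1]

lemma quatT_sq : quatT ^ 2 = unitQuaternion ((φ - 1) / 2) (1 / 2) (φ / 2) 0
    (by nlinarith [Real.goldenRatio_sq]) := by
  rw [pow_two, quatT_eq]
  apply unitQuaternion_mul <;> nlinarith [Real.goldenRatio_sq]

lemma quatT_cube : quatT ^ 3 = unitQuaternion ((1 - φ) / 2) (1 / 2) (φ / 2) 0
    (by nlinarith [Real.goldenRatio_sq]) := by
  rw [pow_succ, quatT_sq, quatT_eq]
  apply unitQuaternion_mul <;> nlinarith [Real.goldenRatio_sq]

lemma quatT_pow_four : quatT ^ 4 = unitQuaternion (-φ / 2) ((φ - 1) / 2) (1 / 2) 0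
    (by nlinarith [Real.goldenRatio_sq]) := by
  rw [pow_succ, quatT_cube, quatT_eq]
  apply unitQuaternion_mul <;> nlinarith [Real.goldenRatio_sq]

lemma quatT_pow_five : quatT ^ 5 = quatNegOne := by
  rw [pow_succ, quatT_pow_four, quatT_eq]
  apply unitQuaternion_mul <;> nlinarith [Real.goldenRatio_sq]

/-- This identity and the next three describe how left multiplication by `(1 + i + j + k) / 2`
permutes the left cosets of the binary tetrahedral group in the binary icosahedral group. -/
lemma quatS_mul_quatT : quatS * quatT = quatT ^ 4 * quatS⁻¹ := by
  rw [quatT_pow_four, quatT_eq, quatS, unitQuaternion_inv]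
  apply unitQuaternion_mul_eq_mul <;> ring

lemma quatS_mul_quatT_sq : quatS * quatT ^ 2 = quatT * quatJ := by
  rw [quatT_sq, quatT_eq]
  apply unitQuaternion_mul_eq_mul <;> ring

lemma quatS_mul_quatT_cube : quatS * quatT ^ 3 = quatT ^ 3 * (quatS⁻¹ * quatJ) := by
  have h : quatS⁻¹ * quatJ =
      unitQuaternion (1 / 2) (1 / 2) (1 / 2) (-(1 / 2)) (by norm_num) := by
    rw [quatS, unitQuaternion_inv]
    apply unitQuaternion_mul <;> norm_num
  rw [h, quatT_cube]
  apply unitQuaternion_mul_eq_mul <;> ring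

lemma quatS_mul_quatT_pow_four : quatS * quatT ^ 4 = quatT ^ 2 * (quatS * quatI) := by
  have h : quatS * quatI =
      unitQuaternion (-(1 / 2)) (1 / 2) (1 / 2) (-(1 / 2)) (by norm_num) := by
    apply unitQuaternion_mul <;> norm_num
  rw [h, quatT_pow_four, quatT_sq]
  apply unitQuaternion_mul_eq_mul <;> ring

lemma goldenRatio_notMem_rat : φ ∉ (Rat.castHom ℝ).range :=
  Real.goldenRatio_irrational

/-- One coordinate of each of these powers is `± φ / 2`, which is irrational. -/
lemma quatT_pow_notMem_tetrahedral {m : ℕ} (hm : 0 < m) (hm' : m < 5) :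
    quatT ^ m ∉ Subgroup.closure {quatI, quatS} := by
  intro h
  have h1 := closure_quatI_quatS_le h
  refine goldenRatio_notMem_rat ?_
  interval_cases m
  · rw [pow_one, quatT_eq, unitQuaternion_mem_coordSubgroup] at h1
    convert! add_mem h1.1 h1.1 using 1
    ring
  · rw [quatT_sq, unitQuaternion_mem_coordSubgroup] at h1
    convert! add_mem h1.2.2.1 h1.2.2.1 using 1
    ring
  · rw [quatT_cube, unitQuaternion_mem_coordSubgroup] at h1
    convert! add_mem h1.2.2.1 h1.2.2.1 using 1
    ring
  · rw [quatT_pow_four, unitQuaternion_mem_coordSubgroup] at h1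
    convert! neg_mem (add_mem h1.1 h1.1) using 1
    ring

/-- The binary icosahedral group is the union of five left cosets of the binary tetrahedral
group, represented by the powers of an element of order ten. -/
lemma card_binaryIcosahedral : Nat.card (Subgroup.closure {quatS, quatT}) = 120 := by
  have hI : quatI ∈ Subgroup.closure {quatI, quatS} := Subgroup.subset_closure (by simp)
  have hS : quatS ∈ Subgroup.closure {quatI, quatS} := Subgroup.subset_closure (by simp)
  have hS' : quatS ∈ Subgroup.closure {quatS, quatT} := Subgroup.subset_closure (by simp)
  have hT' : quatT ∈ Subgroup.closure {quatS, quatT} := Subgroup.subset_closure (by simp)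
  have hJ' : quatJ ∈ Subgroup.closure {quatS, quatT} := by
    have : quatJ = quatT⁻¹ * (quatS * quatT ^ 2) := by
      rw [quatS_mul_quatT_sq, inv_mul_cancel_left]
    rw [this]
    exact mul_mem (inv_mem hT') (mul_mem hS' (pow_mem hT' 2))
  have hI' : quatI ∈ Subgroup.closure {quatS, quatT} := by
    have : quatI = quatS⁻¹ * (quatJ * quatS) := by
      rw [quatJ_mul_quatS, inv_mul_cancel_left]
    rw [this]
    exact mul_mem (inv_mem hS') (mul_mem hJ' hS')
  rw [card_closure_of_cosets (H := Subgroup.closure {quatI, quatS}) (n := 5)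
    (fun i => quatT ^ (i : ℕ)) ⟨0, pow_zero _⟩, card_binaryTetrahedral]
  · rw [Subgroup.closure_le]
    rintro x (rfl | rfl)
    · exact hI'
    · exact hS'
  · exact fun i => pow_mem hT' _
  · rintro x (rfl | rfl) i
    · fin_cases i
      · exact ⟨0, by simpa using hS⟩
      · exact ⟨4, by simpa [quatS_mul_quatT] using hS⟩
      · exact ⟨1, by simpa [quatS_mul_quatT_sq] using quatJ_mem_tetrahedral⟩
      · refine ⟨3, ?_⟩
        simpa [quatS_mul_quatT_cube] using mul_mem (inv_mem hS) quatJ_mem_tetrahedral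
      · exact ⟨2, by simpa [quatS_mul_quatT_pow_four] using mul_mem hS hI⟩
    · by_cases hi : (i : ℕ) + 1 < 5
      · exact ⟨⟨i + 1, hi⟩, by simp [← pow_succ']⟩
      · refine ⟨0, ?_⟩
        have : (i : ℕ) + 1 = 5 := by omega
        simpa [← pow_succ', this, quatT_pow_five, ← quatI_mul_quatI] using mul_mem hI hI
  · have key : ∀ i j : Fin 5, i < j →
        (quatT ^ (i : ℕ))⁻¹ * quatT ^ (j : ℕ) ∉ Subgroup.closure {quatI, quatS} := by
      intro i j hij
      have hij' : (i : ℕ) < j := hij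
      have : quatT ^ (j : ℕ) = quatT ^ (i : ℕ) * quatT ^ ((j : ℕ) - i) := by
        rw [← pow_add, Nat.add_sub_cancel' hij'.le]
      rw [this, inv_mul_cancel_left]
      exact quatT_pow_notMem_tetrahedral (by omega) (by omega)
    intro i j h
    rcases lt_trichotomy i j with hij | hij | hij
    · exact absurd h (key i j hij)
    · exact hij
    · refine absurd ?_ (key j i hij)
      simpa using inv_mem h

/-- The level `k = |G_Δ|` in closed form. -/
def level : ADEType → ℕ
  | A n _ => n + 1
  | D n _ => 4 * (n - 2)
  | E6 => 24
  | E7 => 48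
  | E8 => 120

lemma groupOrder_eq_level (Δ : ADEType) : Δ.groupOrder = Δ.level := by
  cases Δ with
  | A n hn =>
    have := orderOf_rotation (m := n + 1) n.succ_pos
    rw [Nat.cast_succ] at this
    rw [groupOrder, kleinianGroup, ← Subgroup.zpowers_eq_closure, Nat.card_zpowers, this, level]
  | D n hn =>
    have := card_binaryDihedral (N := n - 2) (by omega)
    rw [Nat.cast_sub (by omega), Nat.cast_ofNat] at this
    rw [groupOrder, kleinianGroup, this, level]
  | E6 => exact card_binaryTetrahedral
  | E7 => exact card_binaryOctahedral
  | E8 => exact card_binaryIcosahedral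

end ADEType

end KleinianGroups

section EtaFunction

/-! ### Transformation of the eta function -/

open UpperHalfPlane ModularForm

open scoped MatrixGroups Manifold

namespace MultiplierForm

lemma autFactor_base_ne_zero (A : SL(2, ℤ)) (τ : ℍ) :
    ((A 1 0 : ℤ) : ℂ) * (τ : ℂ) + ((A 1 1 : ℤ) : ℂ) ≠ 0 := by
  have := denom_ne_zero (A : GL (Fin 2) ℝ) τ
  simpa [denom] using this

lemma autFactor_ne_zero (w : ℝ) (A : SL(2, ℤ)) (τ : ℍ) : autFactor w A τ ≠ 0 := by
  rw [autFactor, Complex.cpow_def_of_ne_zero (autFactor_base_ne_zero A τ)]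
  exact Complex.exp_ne_zero _

lemma autFactor_neg (w : ℝ) (A : SL(2, ℤ)) (τ : ℍ) :
    autFactor (-w) A τ = (autFactor w A τ)⁻¹ := by
  rw [autFactor, autFactor, Complex.ofReal_neg, Complex.cpow_neg]

lemma autFactor_half_zpow (n : ℤ) (A : SL(2, ℤ)) (τ : ℍ) :
    autFactor (1 / 2) A τ ^ n = autFactor (n / 2) A τ := by
  rw [autFactor, autFactor, ← Complex.cpow_int_mul]
  congr 1
  push_cast
  ring

lemma continuous_autFactor (w : ℝ) (A : SL(2, ℤ)) : Continuous (autFactor w A) := by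
  by_cases hc : A 1 0 = 0
  · have : autFactor w A = fun _ => ((A 1 1 : ℤ) : ℂ) ^ (w : ℂ) := by
      funext τ
      simp [autFactor, hc]
    rw [this]
    exact continuous_const
  · unfold autFactor
    refine Continuous.cpow (by fun_prop) continuous_const fun τ => ?_
    refine Or.inr ?_
    have : (A 1 0 : ℝ) ≠ 0 := by exact_mod_cast hc
    simp [this, τ.im_ne_zero]

end MultiplierForm

open MultiplierForm ADEType

lemma coe_SL_smul (A : SL(2, ℤ)) (τ : ℍ) : ((A • τ : ℍ) : ℂ) =
    (((A 0 0 : ℤ) : ℂ) * τ + ((A 0 1 : ℤ) : ℂ)) / (((A 1 0 : ℤ) : ℂ) * τ + ((A 1 1 : ℤ) : ℂ)) := by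
  rw [coe_specialLinearGroup_apply]
  simp

lemma continuous_SL_smul (A : SL(2, ℤ)) : Continuous fun τ : ℍ => A • τ := by
  rw [isEmbedding_coe.continuous_iff]
  have : (UpperHalfPlane.coe ∘ fun τ : ℍ => A • τ) = fun τ : ℍ =>
      (((A 0 0 : ℤ) : ℂ) * τ + ((A 0 1 : ℤ) : ℂ)) / (((A 1 0 : ℤ) : ℂ) * τ + ((A 1 1 : ℤ) : ℂ)) :=
    funext (coe_SL_smul A)
  rw [this]
  exact Continuous.div (by fun_prop) (by fun_prop) (autFactor_base_ne_zero A)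

lemma continuous_eta : Continuous fun τ : ℍ => eta (τ : ℂ) := by
  have h : ContinuousOn eta upperHalfPlaneSet := fun z hz =>
    (differentiableAt_eta_of_mem_upperHalfPlaneSet hz).continuousAt.continuousWithinAt
  exact h.comp_continuous continuous_coe fun τ => τ.2

/-- The transformation law of the Dedekind eta function, without the explicit value of the
multiplier. The quotient of both sides is continuous and, since `η ^ 24` is a modular form of
weight 12, takes values in the 24th roots of unity; so it is constant. -/
theorem exists_eta_smul (A : SL(2, ℤ)) : ∃ ε : ℂ, ‖ε‖ = 1 ∧ ∀ τ : ℍ,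
    eta ((A • τ : ℍ) : ℂ) = ε * autFactor (1 / 2) A τ * eta (τ : ℂ) := by
  set R : ℍ → ℂ := fun τ => eta ((A • τ : ℍ) : ℂ) / (autFactor (1 / 2) A τ * eta (τ : ℂ)) with hR
  have hne : ∀ τ : ℍ, autFactor (1 / 2) A τ * eta (τ : ℂ) ≠ 0 := fun τ =>
    mul_ne_zero (autFactor_ne_zero _ _ _) (eta_ne_zero τ.2)
  have hcont : Continuous R :=
    (continuous_eta.comp (continuous_SL_smul A)).div
      ((continuous_autFactor _ _).mul continuous_eta) hne
  have hpow : ∀ τ, R τ ^ 24 = 1 := by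
    intro τ
    have h1 := congrFun (SlashInvariantForm.slash_action_generators_SL2Z discriminant_S_invariant
      discriminant_T_invariant A) τ
    have h4 := autFactor_base_ne_zero A τ
    have h2 : eta ((A • τ : ℍ) : ℂ) ^ 24 =
        (((A 1 0 : ℤ) : ℂ) * (τ : ℂ) + ((A 1 1 : ℤ) : ℂ)) ^ 12 * eta (τ : ℂ) ^ 24 := by
      rw [SL_slash_apply] at h1
      simp [discriminant, denom] at h1
      have h5 : eta ((A • τ : ℍ) : ℂ) ^ 24 *
          ((((A 1 0 : ℤ) : ℂ) * (τ : ℂ) + ((A 1 1 : ℤ) : ℂ)) ^ 12)⁻¹ = eta (τ : ℂ) ^ 24 := h1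
      rw [← h5, mul_comm, inv_mul_cancel_right₀ (pow_ne_zero _ h4)]
    have h3 : autFactor (1 / 2) A τ ^ 24 =
        (((A 1 0 : ℤ) : ℂ) * (τ : ℂ) + ((A 1 1 : ℤ) : ℂ)) ^ 12 := by
      rw [autFactor, ← Complex.cpow_nat_mul, ← Complex.cpow_natCast]
      norm_num
    simp only [hR]
    rw [div_pow, mul_pow, h3, h2]
    exact div_self (mul_ne_zero (pow_ne_zero _ h4) (pow_ne_zero _ (eta_ne_zero τ.2)))
  have hfin : {z : ℂ | z ^ 24 = 1}.Finite := by
    have : {z : ℂ | z ^ 24 = 1} ⊆ ((Polynomial.nthRoots 24 (1 : ℂ)).toFinset : Set ℂ) := by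
      intro z hz
      simpa [Polynomial.mem_nthRoots] using hz
    exact (Finset.finite_toSet _).subset this
  obtain ⟨ε, hε, hRε⟩ := isPreconnected_univ.eqOn_const_of_mapsTo hfin.isDiscrete
    hcont.continuousOn (fun τ _ => hpow τ) ⟨1, one_pow _⟩
  refine ⟨ε, Complex.norm_eq_one_of_pow_eq_one (n := 24) hε (by norm_num), fun τ => ?_⟩
  have h5 : R τ = ε := hRε (Set.mem_univ τ)
  rw [mul_assoc, ← h5, hR]
  exact (div_mul_cancel₀ _ (hne τ)).symm

/-! ### Expansion of `η(m τ)` at a cusp -/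

/-- The Euler product `∏ (1 - q ^ n)`. -/
noncomputable def eulerProduct (q : ℂ) : ℂ := ∏' n : ℕ, (1 - q ^ (n + 1))

lemma eulerProduct_ne_zero {q : ℂ} (hq : ‖q‖ < 1) : eulerProduct q ≠ 0 := by
  have := tprod_one_add_ne_zero_of_summable (f := fun n : ℕ => -q ^ (n + 1)) (fun n => ?_) ?_
  · simpa [eulerProduct, sub_eq_add_neg] using this
  · intro h
    have h1 : q ^ (n + 1) = 1 := by linear_combination -h
    exact hq.ne (Complex.norm_eq_one_of_pow_eq_one h1 n.succ_ne_zero)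
  · simpa using (summable_nat_add_iff 1).mpr (summable_geometric_of_lt_one (norm_nonneg _) hq)

lemma eta_eq (z : ℂ) : eta z = Complex.exp (2 * Real.pi * Complex.I * z / 24) *
    eulerProduct (Complex.exp (2 * Real.pi * Complex.I * z)) := by
  simp [eta, eulerProduct, eta_q, Function.Periodic.qParam]

lemma det_SL_fin_two (A : SL(2, ℤ)) : A 0 0 * A 1 1 - A 0 1 * A 1 0 = 1 := by
  have := A.det_coe
  rwa [Matrix.det_fin_two] at this

/-- A matrix `diag(m, 1) * A` with `A ∈ SL(2, ℤ)` is the product of a matrix `B ∈ SL(2, ℤ)` and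
an upper triangular one with diagonal `(g, m / g)`, where `g` is the greatest common divisor of `m`
and the lower left entry of `A`. -/
lemma exists_hermite (A : SL(2, ℤ)) {m : ℕ} (hm : 0 < m) : ∃ (B : SL(2, ℤ)) (y : ℤ) (g z : ℕ),
    g = Int.gcd (A 1 0) m ∧ g * z = m ∧ m * A 0 0 = B 0 0 * g ∧ A 1 0 = B 1 0 * g ∧
      m * A 0 1 = B 0 0 * y + B 0 1 * z ∧ A 1 1 = B 1 0 * y + B 1 1 * z := by
  have hdet := det_SL_fin_two A
  set g := Int.gcd (A 1 0) m with hg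
  have hgpos : 0 < g := Int.gcd_pos_of_ne_zero_right _ (by omega)
  obtain ⟨c', hc'⟩ : (g : ℤ) ∣ A 1 0 := Int.gcd_dvd_left ..
  obtain ⟨z, hz⟩ : g ∣ m := by
    have : (g : ℤ) ∣ m := Int.gcd_dvd_right ..
    exact_mod_cast this
  have hz' : (m : ℤ) = g * z := by exact_mod_cast hz
  have hcop : IsCoprime (z * A 0 0) c' := by
    refine IsCoprime.mul_left ?_ ?_
    · rw [Int.isCoprime_iff_gcd_eq_one]
      have h1 : Int.gcd (g * c') (g * z) = g * Int.gcd c' z := by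
        rw [Int.gcd_mul_left, Int.natAbs_natCast]
      rw [← hc', ← hz', ← hg] at h1
      rw [Int.gcd_comm]
      exact Nat.eq_of_mul_eq_mul_left hgpos (by omega)
    · exact ⟨A 1 1, -(A 0 1 * g), by rw [hc'] at hdet; linear_combination hdet⟩
  obtain ⟨q, p, hqp⟩ := hcop
  refine ⟨⟨!![z * A 0 0, -p; c', q], by rw [Matrix.det_fin_two_of]; linear_combination hqp⟩,
    q * (m * A 0 1) + p * A 1 1, g, z, rfl, hz.symm, ?_, ?_, ?_, ?_⟩
  · simp [hz']; ring
  · simp [hc']; ring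
  · rw [hc'] at hdet
    simp [hz']
    linear_combination (-g * z * A 0 1 : ℤ) * hqp - p * z * hdet
  · rw [hc'] at hdet
    simp [hz']
    linear_combination (-A 1 1 : ℤ) * hqp + q * z * hdet

/-- A positive real factor does not change the argument, so it can be taken out of the principal
power. -/
lemma ofReal_mul_cpow {r : ℝ} (hr : 0 < r) {z : ℂ} (hz : z ≠ 0) (w : ℂ) :
    ((r : ℂ) * z) ^ w = (r : ℂ) ^ w * z ^ w := by
  have hr' : (r : ℂ) ≠ 0 := by exact_mod_cast hr.ne'
  rw [Complex.cpow_def_of_ne_zero (mul_ne_zero hr' hz), Complex.cpow_def_of_ne_zero hr',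
    Complex.cpow_def_of_ne_zero hz, Complex.log_ofReal_mul hr hz, ← Complex.ofReal_log hr.le,
    ← Complex.exp_add]
  ring_nf

/-- The expansion of `η(m τ)` at the cusp `A ∞`, in terms of the local parameter
`exp (2 π i τ / N)` for any multiple `N` of `m`: `m (A τ) = B ((g τ + y) / z)` with `B ∈ SL(2, ℤ)`
and `g z = m`, and the transformation law of `η` under `B` applies. -/
theorem exists_etaScaled_smul (A : SL(2, ℤ)) {m N : ℕ} (hN : 0 < N) (hmN : m ∣ N) :
    ∃ (C ζ : ℂ) (e : ℕ), C ≠ 0 ∧ ‖ζ‖ = 1 ∧ 0 < e ∧ ∀ τ : ℍ,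
      etaScaled m (A • τ) = C * autFactor (1 / 2) A τ *
        Complex.exp (2 * Real.pi * Complex.I *
          (((Int.gcd (A 1 0) m : ℝ) ^ 2 / (24 * m) : ℝ) : ℂ) * τ) *
        eulerProduct (ζ * Complex.exp (2 * Real.pi * Complex.I * τ / N) ^ e) := by
  have hm : 0 < m := Nat.pos_of_dvd_of_pos hmN hN
  obtain ⟨B, y, g, z, hg, hgz, h00, h10, h01, h11⟩ := exists_hermite A hm
  obtain ⟨ε, hε, hB⟩ := exists_eta_smul B
  obtain ⟨l, hl⟩ := hmN
  have hgpos : 0 < g := Nat.pos_of_mul_pos_right (hgz ▸ hm)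
  have hzpos : 0 < z := Nat.pos_of_mul_pos_left (hgz ▸ hm)
  have hlpos : 0 < l := Nat.pos_of_mul_pos_left (hl ▸ hN)
  have hz0 : (z : ℂ) ≠ 0 := by exact_mod_cast hzpos.ne'
  have hg0 : (g : ℂ) ≠ 0 := by exact_mod_cast hgpos.ne'
  have hl0 : (l : ℂ) ≠ 0 := by exact_mod_cast hlpos.ne'
  have hgzC : (m : ℂ) = g * z := by exact_mod_cast hgz.symm
  have hlC : (N : ℂ) = m * l := by exact_mod_cast hl
  have h00C : (m : ℂ) * ((A 0 0 : ℤ) : ℂ) = ((B 0 0 : ℤ) : ℂ) * g := by exact_mod_cast h00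
  have h10C : ((A 1 0 : ℤ) : ℂ) = ((B 1 0 : ℤ) : ℂ) * g := by exact_mod_cast h10
  have h01C : (m : ℂ) * ((A 0 1 : ℤ) : ℂ) = ((B 0 0 : ℤ) : ℂ) * y + ((B 0 1 : ℤ) : ℂ) * z := by
    exact_mod_cast h01
  have h11C : ((A 1 1 : ℤ) : ℂ) = ((B 1 0 : ℤ) : ℂ) * y + ((B 1 1 : ℤ) : ℂ) * z := by
    exact_mod_cast h11
  have him : ∀ τ : ℍ, 0 < (((g : ℂ) * τ + y) / z).im := by
    intro τ
    have : 0 < (g : ℝ) * τ.im / z := by have := τ.im_pos; positivity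
    simpa [Complex.div_natCast_im] using this
  refine ⟨ε * ((z⁻¹ : ℝ) : ℂ) ^ (((1 / 2 : ℝ) : ℂ)) *
      Complex.exp (2 * Real.pi * Complex.I * (y / z) / 24),
    Complex.exp (2 * Real.pi * Complex.I * (y / z)), g * g * l, ?_, ?_, by positivity, ?_⟩
  · refine mul_ne_zero (mul_ne_zero (norm_ne_zero_iff.mp (by rw [hε]; exact one_ne_zero)) ?_)
      (Complex.exp_ne_zero _)
    rw [Complex.cpow_def_of_ne_zero (by simpa using hz0)]
    exact Complex.exp_ne_zero _
  · rw [show 2 * (Real.pi : ℂ) * Complex.I * ((y : ℂ) / z) =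
      ((2 * Real.pi * (y / z) : ℝ) : ℂ) * Complex.I by push_cast; ring]
    exact Complex.norm_exp_ofReal_mul_I _
  intro τ
  have hA := autFactor_base_ne_zero A τ
  -- With this `τ'` one has `m (A τ) = B τ'`, and `B 1 0 * τ' + B 1 1` is `z⁻¹` times
  -- `A 1 0 * τ + A 1 1`.
  set τ' : ℍ := ⟨((g : ℂ) * τ + y) / z, him τ⟩ with hτ'
  have hτ'C : (τ' : ℂ) = ((g : ℂ) * τ + y) / z := rfl
  have hden : ((B 1 0 : ℤ) : ℂ) * (τ' : ℂ) + ((B 1 1 : ℤ) : ℂ) =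
      ((z⁻¹ : ℝ) : ℂ) * (((A 1 0 : ℤ) : ℂ) * (τ : ℂ) + ((A 1 1 : ℤ) : ℂ)) := by
    rw [hτ'C, h10C, h11C]
    push_cast
    field_simp
    ring
  have hnum : ((B 0 0 : ℤ) : ℂ) * (τ' : ℂ) + ((B 0 1 : ℤ) : ℂ) =
      ((z⁻¹ : ℝ) : ℂ) * (m * (((A 0 0 : ℤ) : ℂ) * (τ : ℂ) + ((A 0 1 : ℤ) : ℂ))) := by
    rw [hτ'C, mul_add, ← mul_assoc, h00C, h01C]
    push_cast
    field_simp
    ring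
  have hpt : (m : ℂ) * ((A • τ : ℍ) : ℂ) = ((B • τ' : ℍ) : ℂ) := by
    rw [coe_SL_smul, coe_SL_smul, hden, hnum, mul_div_mul_left _ _ (by simpa using hz0)]
    ring
  have haut : autFactor (1 / 2) B τ' =
      ((z⁻¹ : ℝ) : ℂ) ^ (((1 / 2 : ℝ) : ℂ)) * autFactor (1 / 2) A τ := by
    rw [autFactor, hden, ofReal_mul_cpow (by positivity) hA, autFactor]
  have hexp : Complex.exp (2 * Real.pi * Complex.I * τ' / 24) =
      Complex.exp (2 * Real.pi * Complex.I * (y / z) / 24) *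
        Complex.exp (2 * Real.pi * Complex.I *
          (((Int.gcd (A 1 0) m : ℝ) ^ 2 / (24 * m) : ℝ) : ℂ) * τ) := by
    rw [← Complex.exp_add, ← hg, hτ'C]
    congr 1
    push_cast
    rw [hgzC]
    field_simp
    ring
  have hq : Complex.exp (2 * Real.pi * Complex.I * τ') =
      Complex.exp (2 * Real.pi * Complex.I * (y / z)) *
        Complex.exp (2 * Real.pi * Complex.I * τ / N) ^ (g * g * l) := by
    rw [← Complex.exp_nat_mul, ← Complex.exp_add, hτ'C]
    congr 1
    rw [hlC, hgzC]
    push_cast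
    field_simp
    ring
  rw [etaScaled, hpt, hB τ', haut, eta_eq, hexp, hq]
  ring

/-! ### Eta quotients -/

/-- The eta quotient `∏ η(m i τ) ^ r i`. -/
noncomputable def etaQuotient {ι : Type*} [Fintype ι] (m : ι → ℕ) (r : ι → ℤ) (τ : ℍ) : ℂ :=
  ∏ i, etaScaled (m i) τ ^ r i

/-- The order of the eta quotient `∏ η(m i τ) ^ r i` at the cusps whose denominator is `c`, where
`∞ = 1 / 0` has denominator `0`. -/
noncomputable def etaOrder {ι : Type*} [Fintype ι] (m : ι → ℕ) (r : ι → ℤ) (c : ℕ) : ℝ :=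
  ∑ i, r i * ((Nat.gcd c (m i) : ℝ) ^ 2 / (24 * m i))

lemma prod_zpow₀ {ι K : Type*} [Field K] {s : Finset ι} {x : K} (hx : x ≠ 0) (r : ι → ℤ) :
    ∏ i ∈ s, x ^ r i = x ^ ∑ i ∈ s, r i := by
  classical
  induction s using Finset.induction_on with
  | empty => simp
  | insert i s hi ih => rw [Finset.prod_insert hi, Finset.sum_insert hi, zpow_add₀ hx, ih]

section EtaQuotient

variable {ι : Type*} [Fintype ι] {m : ι → ℕ} {r : ι → ℤ} {N : ℕ}

lemma differentiableOn_eulerProduct : DifferentiableOn ℂ eulerProduct (Metric.ball 0 1) :=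
  differentiableOn_tprod_one_sub_pow

lemma norm_exp_div_lt_one (hN : 0 < N) (τ : ℍ) :
    ‖Complex.exp (2 * Real.pi * Complex.I * τ / N)‖ < 1 := by
  have hN' : (0 : ℝ) < N := by exact_mod_cast hN
  have := Function.Periodic.norm_qParam_lt_one hN' τ.im_pos
  simpa [Function.Periodic.qParam] using this

/-- Near every cusp, an eta quotient is a power of `q` times a holomorphic function of
`q ^ (1 / N)` with nonzero constant term, because this holds for each factor. -/
theorem exists_fourierExpansion_slash_etaQuotient (hN : 0 < N) (hm : ∀ i, m i ∣ N) (A : SL(2, ℤ)) :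
    ∃ a : ℕ → ℂ, a 0 ≠ 0 ∧
      HasFourierExpansion (slash (((∑ i, r i : ℤ) : ℝ) / 2) (etaQuotient m r) A)
        (etaOrder m r (A 1 0).natAbs) N a := by
  choose C ζ e hC hζ he h using fun i => exists_etaScaled_smul A hN (hm i)
  -- The cofactor of the power of `q`, as a function of `q ^ (1 / N)`.
  set F : ℂ → ℂ := fun q => ∏ i, (C i ^ r i * eulerProduct (ζ i * q ^ e i) ^ r i) with hF
  have hball : ∀ i, ∀ q ∈ Metric.ball (0 : ℂ) 1, ‖ζ i * q ^ e i‖ < 1 := by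
    intro i q hq
    rw [norm_mul, hζ, one_mul, norm_pow]
    exact pow_lt_one₀ (norm_nonneg _) (by simpa using hq) (he i).ne'
  have hFdiff : DifferentiableOn ℂ F (Metric.ball 0 1) := by
    refine DifferentiableOn.fun_finsetProd fun i _ => ?_
    refine DifferentiableOn.const_mul (DifferentiableOn.zpow ?_ ?_) _
    · exact differentiableOn_eulerProduct.comp (by fun_prop)
        fun q hq => by simpa using hball i q hq
    · exact Or.inl fun q hq => eulerProduct_ne_zero (hball i q hq)
  have hF0 : F 0 ≠ 0 := by
    refine Finset.prod_ne_zero_iff.mpr fun i _ => mul_ne_zero (zpow_ne_zero _ (hC i)) ?_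
    exact zpow_ne_zero _ (eulerProduct_ne_zero (hball i 0 (by simp)))
  have hslash : ∀ τ : ℍ, slash (((∑ i, r i : ℤ) : ℝ) / 2) (etaQuotient m r) A τ =
      Complex.exp (2 * Real.pi * Complex.I * ((etaOrder m r (A 1 0).natAbs : ℝ) : ℂ) * τ) *
        F (Complex.exp (2 * Real.pi * Complex.I * τ / N)) := by
    intro τ
    have hexp : Complex.exp
        (2 * Real.pi * Complex.I * ((etaOrder m r (A 1 0).natAbs : ℝ) : ℂ) * τ) =
        ∏ i, Complex.exp (2 * Real.pi * Complex.I *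
          (((Int.gcd (A 1 0) (m i) : ℝ) ^ 2 / (24 * m i) : ℝ) : ℂ) * τ) ^ r i := by
      simp_rw [← Complex.exp_int_mul, ← Complex.exp_sum]
      congr 1
      rw [etaOrder, Complex.ofReal_sum, Finset.mul_sum, Finset.sum_mul]
      refine Finset.sum_congr rfl fun i _ => ?_
      rw [Int.gcd, Int.natAbs_natCast]
      push_cast
      ring
    have hprod : etaQuotient m r (A • τ) = autFactor (((∑ i, r i : ℤ) : ℝ) / 2) A τ *
        (Complex.exp (2 * Real.pi * Complex.I * ((etaOrder m r (A 1 0).natAbs : ℝ) : ℂ) * τ) *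
          F (Complex.exp (2 * Real.pi * Complex.I * τ / N))) := by
      rw [hexp, hF, ← autFactor_half_zpow, etaQuotient, ← Finset.prod_mul_distrib,
        ← prod_zpow₀ (autFactor_ne_zero _ _ _), ← Finset.prod_mul_distrib]
      refine Finset.prod_congr rfl fun i _ => ?_
      rw [h i τ, mul_zpow, mul_zpow, mul_zpow]
      ring
    rw [slash, hprod, autFactor_neg, inv_mul_cancel_left₀ (autFactor_ne_zero _ _ _)]
  refine ⟨fun n => (n.factorial : ℂ)⁻¹ * iteratedDeriv n F 0, by simpa using hF0, fun τ => ?_⟩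
  have hτ := norm_exp_div_lt_one hN τ
  have hsum := Complex.hasSum_taylorSeries_on_ball hFdiff
    (z := Complex.exp (2 * Real.pi * Complex.I * τ / N)) (by simpa using hτ)
  rw [hslash τ]
  convert! hsum.mul_left (Complex.exp
    (2 * Real.pi * Complex.I * ((etaOrder m r (A 1 0).natAbs : ℝ) : ℂ) * τ)) using 1
  funext n
  have hexp : Complex.exp (2 * Real.pi * Complex.I *
      (((etaOrder m r (A 1 0).natAbs + (n : ℝ) / (N : ℝ) : ℝ)) : ℂ) * (τ : ℂ)) =
      Complex.exp (2 * Real.pi * Complex.I * ((etaOrder m r (A 1 0).natAbs : ℝ) : ℂ) * τ) *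
        Complex.exp (2 * Real.pi * Complex.I * τ / N) ^ n := by
    rw [← Complex.exp_nat_mul, ← Complex.exp_add]
    congr 1
    push_cast
    ring
  rw [hexp, sub_zero, smul_eq_mul]
  ring

/-- For `A ∈ Γ₀(M)`, the conjugate of `A` by `diag(M, 1)` lies in `SL(2, ℤ)`. -/
lemma exists_norm_one_etaScaled_smul {M : ℕ} (hM : 0 < M) {A : SL(2, ℤ)}
    (hA : (M : ℤ) ∣ A 1 0) :
    ∃ ε : ℂ, ‖ε‖ = 1 ∧ ∀ τ : ℍ,
      etaScaled M (A • τ) = ε * autFactor (1 / 2) A τ * etaScaled M τ := by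
  obtain ⟨c', hc'⟩ := hA
  have hdet := det_SL_fin_two A
  set B : SL(2, ℤ) := ⟨!![A 0 0, M * A 0 1; c', A 1 1], by
    rw [hc'] at hdet; rw [Matrix.det_fin_two_of]; linear_combination hdet⟩ with hB
  have h00 : B 0 0 = A 0 0 := rfl
  have h01 : B 0 1 = M * A 0 1 := rfl
  have h10 : B 1 0 = c' := rfl
  have h11 : B 1 1 = A 1 1 := rfl
  obtain ⟨ε, hε, h⟩ := exists_eta_smul B
  refine ⟨ε, hε, fun τ => ?_⟩
  have him : 0 < ((M : ℂ) * τ).im := by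
    have : (0 : ℝ) < M := by exact_mod_cast hM
    simpa using mul_pos this τ.im_pos
  set τ' : ℍ := ⟨(M : ℂ) * τ, him⟩ with hτ'
  have hτ'C : (τ' : ℂ) = (M : ℂ) * τ := rfl
  have hden : ((B 1 0 : ℤ) : ℂ) * (τ' : ℂ) + ((B 1 1 : ℤ) : ℂ) =
      ((A 1 0 : ℤ) : ℂ) * (τ : ℂ) + ((A 1 1 : ℤ) : ℂ) := by
    rw [hτ'C, h10, h11, hc']
    push_cast
    ring
  have hpt : (M : ℂ) * ((A • τ : ℍ) : ℂ) = ((B • τ' : ℍ) : ℂ) := by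
    rw [coe_SL_smul, coe_SL_smul, hden, h00, h01, hτ'C, ← mul_div_assoc]
    push_cast
    ring
  rw [etaScaled, hpt, h τ', autFactor, hden, ← autFactor, hτ'C, ← etaScaled]

lemma exists_norm_one_etaQuotient_smul (hN : 0 < N) (hm : ∀ i, m i ∣ N) {A : SL(2, ℤ)}
    (hA : (N : ℤ) ∣ A 1 0) :
    ∃ ε : ℂ, ‖ε‖ = 1 ∧ ∀ τ : ℍ,
      etaQuotient m r (A • τ) =
        ε * autFactor (((∑ i, r i : ℤ) : ℝ) / 2) A τ * etaQuotient m r τ := by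
  choose ε hε h using fun i => exists_norm_one_etaScaled_smul
    (Nat.pos_of_dvd_of_pos (hm i) hN) (dvd_trans (Int.natCast_dvd_natCast.mpr (hm i)) hA)
  refine ⟨∏ i, ε i ^ r i, by simp [norm_prod, hε], fun τ => ?_⟩
  rw [etaQuotient, etaQuotient, ← autFactor_half_zpow, ← prod_zpow₀ (autFactor_ne_zero _ _ _),
    ← Finset.prod_mul_distrib, ← Finset.prod_mul_distrib]
  exact Finset.prod_congr rfl fun i _ => by rw [h i τ, mul_zpow, mul_zpow]

lemma mdifferentiable_etaQuotient (hm : ∀ i, 0 < m i) : MDiff (etaQuotient m r) := by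
  rw [UpperHalfPlane.mdifferentiable_iff]
  have h : DifferentiableOn ℂ (fun z : ℂ => ∏ i, eta ((m i : ℂ) * z) ^ r i)
      upperHalfPlaneSet := by
    refine DifferentiableOn.fun_finsetProd fun i _ => ?_
    have hmem : ∀ z ∈ upperHalfPlaneSet, (m i : ℂ) * z ∈ upperHalfPlaneSet := fun z hz => by
      have : (0 : ℝ) < m i := by exact_mod_cast hm i
      simpa [upperHalfPlaneSet] using mul_pos this hz
    refine DifferentiableOn.zpow (fun z hz => ?_) (Or.inl fun z hz => eta_ne_zero (hmem z hz))
    exact ((differentiableAt_eta_of_mem_upperHalfPlaneSet (hmem z hz)).comp z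
      (by fun_prop)).differentiableWithinAt
  refine h.congr fun z hz => ?_
  simp [etaQuotient, etaScaled, ofComplex_apply_of_im_pos hz]

lemma exists_isModularForm_etaQuotient (hN : 0 < N) (hm : ∀ i, m i ∣ N)
    (hord : ∀ c, 0 ≤ etaOrder m r c) :
    ∃ χ : CongruenceSubgroup.Gamma0 N → ℂ,
      IsModularForm (((∑ i, r i : ℤ) : ℝ) / 2) (CongruenceSubgroup.Gamma0 N) χ
        (etaQuotient m r) := by
  have hdvd : ∀ A : CongruenceSubgroup.Gamma0 N, (N : ℤ) ∣ (A : SL(2, ℤ)) 1 0 := fun A =>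
    (ZMod.intCast_zmod_eq_zero_iff_dvd _ _).mp (CongruenceSubgroup.Gamma0_mem.mp A.2)
  choose χ hχ h using fun A => exists_norm_one_etaQuotient_smul (r := r) hN hm (hdvd A)
  have : NeZero N := ⟨hN.ne'⟩
  refine ⟨χ, (CongruenceSubgroup.Gamma0_is_congruence N).finiteIndex, hχ,
    mdifferentiable_etaQuotient fun i => Nat.pos_of_dvd_of_pos (hm i) hN, h, fun s A _ => ?_⟩
  obtain ⟨a, -, ha⟩ := exists_fourierExpansion_slash_etaQuotient (r := r) hN hm A
  exact ⟨_, N, a, hord _, hN, ha⟩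

lemma hasOrderAtCusp_infty_etaQuotient (hN : 0 < N) (hm : ∀ i, m i ∣ N) :
    HasOrderAtCusp (((∑ i, r i : ℤ) : ℝ) / 2) (etaQuotient m r) OnePoint.infty
      (etaOrder m r 0) := by
  intro A hA
  have hA0 : A 1 0 = 0 := by
    rw [OnePoint.smul_infty_eq_self_iff] at hA
    simpa using hA
  obtain ⟨a, ha0, ha⟩ := exists_fourierExpansion_slash_etaQuotient (r := r) hN hm A
  rw [hA0, Int.natAbs_zero] at ha
  exact ⟨N, a, hN, ha0, ha⟩

/-- A matrix that sends `∞` to `1 / c` has first column `± (1, c)`. -/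
lemma natAbs_lower_left_of_smul_infty_eq {A : SL(2, ℤ)} {c : ℕ} (hc : c ≠ 0)
    (hA : Matrix.SpecialLinearGroup.mapGL ℚ A • (OnePoint.infty : OnePoint ℚ) =
      (((1 : ℚ) / (c : ℚ) : ℚ) : OnePoint ℚ)) : (A 1 0).natAbs = c := by
  have hdet := det_SL_fin_two A
  rw [OnePoint.smul_infty_eq_ite] at hA
  split_ifs at hA with h0
  · simp at hA
  · have h1 : (A 1 0 : ℚ) ≠ 0 := by simpa using h0
    have h2 : (A 0 0 : ℚ) / (A 1 0 : ℚ) = 1 / (c : ℚ) := by simpa using hA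
    have hc' : (c : ℚ) ≠ 0 := by exact_mod_cast hc
    rw [div_eq_div_iff h1 hc', one_mul] at h2
    have h3 : A 0 0 * c = A 1 0 := by exact_mod_cast h2
    have h4 : IsUnit (A 0 0) := IsUnit.of_mul_eq_one (A 1 1 - A 0 1 * c) (by
      rw [← h3] at hdet
      linear_combination hdet)
    rw [← h3, Int.natAbs_mul, Int.natAbs_of_isUnit h4, one_mul, Int.natAbs_natCast]

lemma hasOrderAtCusp_one_div_etaQuotient (hN : 0 < N) (hm : ∀ i, m i ∣ N) {c : ℕ} (hc : c ≠ 0) :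
    HasOrderAtCusp (((∑ i, r i : ℤ) : ℝ) / 2) (etaQuotient m r)
      (((1 : ℚ) / (c : ℚ) : ℚ) : OnePoint ℚ) (etaOrder m r c) := by
  intro A hA
  obtain ⟨a, ha0, ha⟩ := exists_fourierExpansion_slash_etaQuotient (r := r) hN hm A
  rw [natAbs_lower_left_of_smul_infty_eq hc hA] at ha
  exact ⟨N, a, hN, ha0, ha⟩

/-- Only the gcd of the denominator with the level matters, so that the order needs to be known only
at the cusps `1 / c` with `c` dividing the level. -/
lemma etaOrder_gcd (hm : ∀ i, m i ∣ N) (c : ℕ) : etaOrder m r (c.gcd N) = etaOrder m r c := by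
  refine Finset.sum_congr rfl fun i _ => ?_
  rw [Nat.gcd_assoc, Nat.gcd_eq_right (hm i)]

/-- An eta quotient whose order is zero at the cusp `1` and positive at `1 / c` for the other
divisors `c` of `N` is a holomorphic modular form for `Γ₀(N)`, and has these orders. -/
theorem isModularForm_and_orders_etaQuotient (hN : 0 < N) (hm : ∀ i, m i ∣ N)
    (hone : etaOrder m r 1 = 0) (hpos : ∀ c, c ∣ N → c ≠ 1 → 0 < etaOrder m r c) :
    (∃ χ : CongruenceSubgroup.Gamma0 N → ℂ,
      IsModularForm (((∑ i, r i : ℤ) : ℝ) / 2) (CongruenceSubgroup.Gamma0 N) χ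
        (etaQuotient m r)) ∧
    HasOrderAtCusp (((∑ i, r i : ℤ) : ℝ) / 2) (etaQuotient m r) ((1 : ℚ) : OnePoint ℚ) 0 ∧
    HasOrderAtCusp (((∑ i, r i : ℤ) : ℝ) / 2) (etaQuotient m r) OnePoint.infty
      (etaOrder m r 0) ∧
    ∀ c : ℕ, c ∣ N → c ≠ 1 → ∃ x : ℝ, 0 < x ∧
      HasOrderAtCusp (((∑ i, r i : ℤ) : ℝ) / 2) (etaQuotient m r)
        (((1 : ℚ) / (c : ℚ) : ℚ) : OnePoint ℚ) x := by
  refine ⟨exists_isModularForm_etaQuotient hN hm fun c => ?_, ?_,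
    hasOrderAtCusp_infty_etaQuotient hN hm, fun c hc hc1 => ⟨_, hpos c hc hc1,
      hasOrderAtCusp_one_div_etaQuotient hN hm (ne_zero_of_dvd_ne_zero hN.ne' hc)⟩⟩
  · rw [← etaOrder_gcd hm]
    by_cases h : c.gcd N = 1
    · rw [h, hone]
    · exact (hpos _ (Nat.gcd_dvd_right c N) h).le
  · have := hasOrderAtCusp_one_div_etaQuotient (r := r) hN hm one_ne_zero
    rwa [hone, Nat.cast_one, div_one] at this

end EtaQuotient

/-! ### The eta products of the root systems -/

namespace ADEType

lemma level_pos (Δ : ADEType) : 0 < Δ.level := by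
  cases Δ <;> simp only [level] <;> omega

/-- The eta product of `Δ` is a holomorphic modular form of weight `n / 2` for `Γ₀(k)` with the
orders `0` at the cusp `1`, `((n + 1) k - 1) / 24` at `∞`, and positive at `1 / c` for the divisors
`c ≠ 1` of `k`, where the level `k` is given in closed form. -/
def HasModularEtaProduct (Δ : ADEType) : Prop :=
  (∃ χ : CongruenceSubgroup.Gamma0 Δ.level → ℂ,
      IsModularForm ((Δ.rank : ℝ) / 2) (CongruenceSubgroup.Gamma0 Δ.level) χ Δ.etaProduct) ∧
    HasOrderAtCusp ((Δ.rank : ℝ) / 2) Δ.etaProduct ((1 : ℚ) : OnePoint ℚ) 0 ∧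
    HasOrderAtCusp ((Δ.rank : ℝ) / 2) Δ.etaProduct OnePoint.infty
      ((((Δ.rank : ℝ) + 1) * (Δ.level : ℝ) - 1) / 24) ∧
    ∀ c : ℕ, c ∣ Δ.level → c ≠ 1 → ∃ r : ℝ, 0 < r ∧
      HasOrderAtCusp ((Δ.rank : ℝ) / 2) Δ.etaProduct (((1 : ℚ) / (c : ℚ) : ℚ) : OnePoint ℚ) r

lemma hasModularEtaProduct_of_etaQuotient {Δ : ADEType} {ι : Type*} [Fintype ι]
    (m : ι → ℕ) (r : ι → ℤ) (hf : Δ.etaProduct = etaQuotient m r) (hr : ∑ i, r i = Δ.rank)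
    (hm : ∀ i, m i ∣ Δ.level) (hone : etaOrder m r 1 = 0)
    (hinf : etaOrder m r 0 = (((Δ.rank : ℝ) + 1) * (Δ.level : ℝ) - 1) / 24)
    (hpos : ∀ c, c ∣ Δ.level → c ≠ 1 → 0 < etaOrder m r c) : Δ.HasModularEtaProduct := by
  have h := isModularForm_and_orders_etaQuotient (r := r) Δ.level_pos hm hone hpos
  rwa [hr, Int.cast_natCast, hinf, ← hf] at h

lemma hasModularEtaProduct_A (n : ℕ) (hn : 1 ≤ n) : (A n hn).HasModularEtaProduct := by
  have hord : ∀ c, c ∣ n + 1 → etaOrder ![n + 1, 1] ![(n : ℤ) + 1, -1] c =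
      ((c : ℝ) ^ 2 - 1) / 24 := by
    intro c hc
    have hn' : (n : ℝ) + 1 ≠ 0 := by positivity
    simp [etaOrder, Nat.gcd_eq_left hc]
    field_simp
    ring
  refine hasModularEtaProduct_of_etaQuotient ![n + 1, 1] ![(n : ℤ) + 1, -1] ?_ ?_ ?_ ?_ ?_ ?_
  · funext τ
    have : etaScaled (n + 1) τ ^ ((n : ℤ) + 1) = etaScaled (n + 1) τ ^ (n + 1) := by
      rw [← zpow_natCast]; push_cast; rfl
    simp [etaProduct, etaQuotient, this, div_eq_mul_inv]
  · simp [rank]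
  · intro i
    fin_cases i <;> simp [level]
  · rw [hord 1 (one_dvd _)]
    norm_num
  · have hn' : (n : ℝ) + 1 ≠ 0 := by positivity
    simp [etaOrder, rank, level]
    field_simp
    ring
  · intro c hc hc1
    rw [hord c hc]
    have h1 : 2 ≤ c := by
      have : c ≠ 0 := ne_zero_of_dvd_ne_zero n.succ_ne_zero hc
      omega
    have h2 : (2 : ℝ) ≤ c := by exact_mod_cast h1
    nlinarith

/-- For `N = n - 2` and `c` dividing `4 N`, `24` times the order at `1 / c` is
`gcd(c, 2) ^ 2 - 1 + (c ^ 2 - gcd(c, 4) ^ 2) / 4 + (c ^ 2 - gcd(c, 2 N) ^ 2) / N`, in which each of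
the three summands is nonnegative. -/
lemma hasModularEtaProduct_D (n : ℕ) (hn : 4 ≤ n) : (D n hn).HasModularEtaProduct := by
  obtain ⟨N, rfl⟩ : ∃ N, n = N + 2 := ⟨n - 2, by omega⟩
  have hN : 0 < N := by omega
  have hN' : (0 : ℝ) < N := by exact_mod_cast hN
  have h4 : 4 * (N + 2) - 8 = 4 * N := by omega
  have h2 : 2 * (N + 2) - 4 = 2 * N := by omega
  have hlev : (D (N + 2) hn).level = 4 * N := rfl
  have hord : ∀ c, etaOrder ![2, 4 * N, 1, 4, 2 * N] ![2, (N : ℤ) + 4, -1, -1, -2] c =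
      ((Nat.gcd c 2 : ℝ) ^ 2 + (N + 4) * (Nat.gcd c (4 * N) : ℝ) ^ 2 / (4 * N) - 1 -
        (Nat.gcd c 4 : ℝ) ^ 2 / 4 - (Nat.gcd c (2 * N) : ℝ) ^ 2 / N) / 24 := by
    intro c
    simp [etaOrder, Fin.sum_univ_five]
    field_simp
    ring
  refine hasModularEtaProduct_of_etaQuotient ![2, 4 * N, 1, 4, 2 * N]
    ![2, (N : ℤ) + 4, -1, -1, -2] ?_ ?_ ?_ ?_ ?_ ?_
  · funext τ
    have : etaScaled (4 * N) τ ^ ((N : ℤ) + 4) = etaScaled (4 * N) τ ^ (N + 4) := by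
      rw [← zpow_natCast]; push_cast; rfl
    simp only [etaProduct, h4, h2, etaQuotient, Fin.prod_univ_five, Matrix.cons_val, this,
      zpow_neg, zpow_ofNat]
    rw [div_eq_mul_inv, mul_inv, mul_inv]
    ring
  · simp [rank, Fin.sum_univ_five]
    ring
  · rw [hlev]
    intro i
    fin_cases i
    · exact ⟨2 * N, by simp; ring⟩
    · simp
    · simp
    · simp
    · exact ⟨2, by simp; ring⟩
  · rw [hord]
    simp
    field_simp
    ring
  · rw [hord, hlev]
    simp [rank]
    field_simp
    ring
  · intro c hc hc1
    rw [hlev] at hc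
    have hc0 : c ≠ 0 := ne_zero_of_dvd_ne_zero (by omega) hc
    have hx : (Nat.gcd c (2 * N) : ℝ) ≤ c := by
      exact_mod_cast Nat.le_of_dvd (by omega) (Nat.gcd_dvd_left _ _)
    have hx' : (Nat.gcd c (2 * N) : ℝ) ^ 2 ≤ (c : ℝ) ^ 2 := by gcongr
    rw [hord, Nat.gcd_eq_left hc]
    refine div_pos ?_ (by norm_num)
    -- The two terms with denominator `N` leave the nonnegative `(c ^ 2 - gcd(c, 2N) ^ 2) / N`.
    have h5 : ((N : ℝ) + 4) * (c : ℝ) ^ 2 / (4 * N) - (Nat.gcd c (2 * N) : ℝ) ^ 2 / N =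
        (c : ℝ) ^ 2 / 4 + ((c : ℝ) ^ 2 - (Nat.gcd c (2 * N) : ℝ) ^ 2) / N := by
      field_simp
      ring
    have h6 : 0 ≤ ((c : ℝ) ^ 2 - (Nat.gcd c (2 * N) : ℝ) ^ 2) / N :=
      div_nonneg (by linarith) hN'.le
    suffices h7 : 0 < (Nat.gcd c 2 : ℝ) ^ 2 - 1 + ((c : ℝ) ^ 2 - (Nat.gcd c 4 : ℝ) ^ 2) / 4 by
      linarith
    rcases Nat.even_or_odd c with he | ho
    · have h8 : Nat.gcd c 2 = 2 := Nat.gcd_eq_right he.two_dvd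
      have h9 : (Nat.gcd c 4 : ℝ) ≤ c := by
        exact_mod_cast Nat.le_of_dvd (by omega) (Nat.gcd_dvd_left _ _)
      have h10 : (Nat.gcd c 4 : ℝ) ^ 2 ≤ (c : ℝ) ^ 2 := by gcongr
      rw [h8]
      push_cast
      linarith
    · have h8 : Nat.gcd c 2 = 1 := (Nat.coprime_two_right).mpr ho
      have h9 : Nat.gcd c 4 = 1 := Nat.Coprime.pow_right 2 h8
      have h10 : (2 : ℝ) ≤ c := by
        have : 2 ≤ c := by omega
        exact_mod_cast this
      rw [h8, h9]
      push_cast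
      nlinarith

lemma hasModularEtaProduct_E6 : E6.HasModularEtaProduct := by
  refine hasModularEtaProduct_of_etaQuotient ![2, 24, 1, 8, 12] ![2, 8, -1, -2, -1]
    ?_ ?_ ?_ ?_ ?_ ?_
  · funext τ
    simp only [etaProduct, etaQuotient, Fin.prod_univ_five, Matrix.cons_val, zpow_neg,
      zpow_ofNat]
    rw [div_eq_mul_inv, mul_inv, mul_inv]
    ring
  · simp [rank, Fin.sum_univ_five]
  · intro i
    fin_cases i <;> simp [level]
  · simp [etaOrder, Fin.sum_univ_five]
    norm_num
  · simp [etaOrder, Fin.sum_univ_five, rank, level]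
    norm_num
  · intro c hc hc1
    have hmem : c ∈ ({1, 2, 3, 4, 6, 8, 12, 24} : Finset ℕ) := by
      rw [show ({1, 2, 3, 4, 6, 8, 12, 24} : Finset ℕ) = Nat.divisors 24 by decide]
      exact Nat.mem_divisors.mpr ⟨hc, by norm_num⟩
    fin_cases hmem <;> simp_all [etaOrder, Fin.sum_univ_five] <;> norm_num

lemma hasModularEtaProduct_E7 : E7.HasModularEtaProduct := by
  refine hasModularEtaProduct_of_etaQuotient ![2, 48, 1, 12, 16, 24] ![2, 9, -1, -1, -1, -1]
    ?_ ?_ ?_ ?_ ?_ ?_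
  · funext τ
    simp only [etaProduct, etaQuotient, Fin.prod_univ_six, Matrix.cons_val, zpow_neg,
      zpow_ofNat]
    rw [div_eq_mul_inv, mul_inv, mul_inv, mul_inv]
    ring
  · simp [rank, Fin.sum_univ_six]
  · intro i
    fin_cases i <;> simp [level]
  · simp [etaOrder, Fin.sum_univ_six]
    norm_num
  · simp [etaOrder, Fin.sum_univ_six, rank, level]
    norm_num
  · intro c hc hc1
    have hmem : c ∈ ({1, 2, 3, 4, 6, 8, 12, 16, 24, 48} : Finset ℕ) := by
      rw [show ({1, 2, 3, 4, 6, 8, 12, 16, 24, 48} : Finset ℕ) = Nat.divisors 48 by decide]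
      exact Nat.mem_divisors.mpr ⟨hc, by norm_num⟩
    fin_cases hmem <;> simp_all [etaOrder, Fin.sum_univ_six] <;> norm_num

lemma hasModularEtaProduct_E8 : E8.HasModularEtaProduct := by
  refine hasModularEtaProduct_of_etaQuotient ![2, 120, 1, 24, 40, 60] ![2, 10, -1, -1, -1, -1]
    ?_ ?_ ?_ ?_ ?_ ?_
  · funext τ
    simp only [etaProduct, etaQuotient, Fin.prod_univ_six, Matrix.cons_val, zpow_neg,
      zpow_ofNat]
    rw [div_eq_mul_inv, mul_inv, mul_inv, mul_inv]
    ring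
  · simp [rank, Fin.sum_univ_six]
  · intro i
    fin_cases i <;> simp [level]
  · simp [etaOrder, Fin.sum_univ_six]
    norm_num
  · simp [etaOrder, Fin.sum_univ_six, rank, level]
    norm_num
  · intro c hc hc1
    have hmem : c ∈ ({1, 2, 3, 4, 5, 6, 8, 10, 12, 15, 20, 24, 30, 40, 60, 120} : Finset ℕ) := by
      rw [show ({1, 2, 3, 4, 5, 6, 8, 10, 12, 15, 20, 24, 30, 40, 60, 120} : Finset ℕ) =
        Nat.divisors 120 by decide]
      exact Nat.mem_divisors.mpr ⟨hc, by norm_num⟩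
    fin_cases hmem <;> simp_all [etaOrder, Fin.sum_univ_six] <;> norm_num

end ADEType

end EtaFunction

theorem corollary3p8 (Δ : ADEType) :
    (∃ χ : CongruenceSubgroup.Gamma0 Δ.groupOrder → ℂ,
      MultiplierForm.IsModularForm ((Δ.rank : ℝ) / 2)
        (CongruenceSubgroup.Gamma0 Δ.groupOrder) χ Δ.etaProduct) ∧
    MultiplierForm.HasOrderAtCusp ((Δ.rank : ℝ) / 2) Δ.etaProduct
      ((1 : ℚ) : OnePoint ℚ) 0 ∧
    MultiplierForm.HasOrderAtCusp ((Δ.rank : ℝ) / 2) Δ.etaProduct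
      OnePoint.infty ((((Δ.rank : ℝ) + 1) * (Δ.groupOrder : ℝ) - 1) / 24) ∧
    ∀ c : ℕ, c ∣ Δ.groupOrder → c ≠ 1 →
      ∃ r : ℝ, 0 < r ∧
        MultiplierForm.HasOrderAtCusp ((Δ.rank : ℝ) / 2) Δ.etaProduct
          (((1 : ℚ) / (c : ℚ) : ℚ) : OnePoint ℚ) r := by
  rw [Δ.groupOrder_eq_level]
  cases Δ with
  | A n hn => exact ADEType.hasModularEtaProduct_A n hn
  | D n hn => exact ADEType.hasModularEtaProduct_D n hn
  | E6 => exact ADEType.hasModularEtaProduct_E6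
  | E7 => exact ADEType.hasModularEtaProduct_E7
  | E8 => exact ADEType.hasModularEtaProduct_E8
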